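/- Let $\mathcal{P}$ be a finite polysquare translation surface, that is, a non-empty connected surface obtained from finitely many unit squares $Q_1,\dots,Q_s$ by gluing, through translations, the right edge of each square to the left edge of a square and the top edge of each square to the bottom edge of a square, so that all edges are glued in pairs. Let $\mathcal{M}=\mathcal{P}\times[0,1)$ be the associated polycube translation $3$-manifold, the cartesian product of $\mathcal{P}$ and the unit torus $[0,1)$: it consists of $s$ unit cubes, glued in the first two directions like the squares of $\mathcal{P}$, and with the two faces of each cube that are perpendicular to the third direction identified with one another. Both carry Lebesgue measure, of total mass $s$. For a step vector $\mathbf{u}$, the $\mathbf{u}$-shift on $\mathcal{P}$ or $\mathcal{M}$ is the map, defined almost everywhere, that moves a point along the geodesic in direction $\mathbf{u}$ by the length $|\mathbf{u}|$; it is called ergodic if it preserves Lebesgue measure and every invariant measurable set is null or has null complement. Let $\mathbf{v}=(v_1,v_2)\in\mathbb{R}^2$ be the step vector of a Kronecker sequence on $\mathcal{P}$, that is, $v_1,v_2,1$ are linearly independent over $\mathbb{Q}$. Then the following two statements are equivalent: (i) The $\mathbf{v}$-shift on $\mathcal{P}$ is ergodic. (ii) For every $w\in\mathbb{R}$ such that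 $\mathbf{w}=(v_1,v_2,w)\in\mathbb{R}^3$ is the step vector of a Kronecker sequence on $\mathcal{M}$, that is, $v_1,v_2,w,1$ are linearly independent over $\mathbb{Q}$, the $\mathbf{w}$-shift on $\mathcal{M}$ is ergodic. -/

import Mathlib

open MeasureTheory

/-- A finite polycube translation `d`-manifold with `s` atomic unit cubes, labelled by `Fin s`
(for `d = 2`: a finite polysquare translation surface). Faces are identified in pairs by
translations: the face `x i = 1` of the cube `q` is glued to the face `x i = 0` of the cube
`glue i q`. The manifold is non-empty and connected. -/
structure PolycubeManifold (d s : ℕ) where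
  pos : 0 < s
  glue : Fin d → Equiv.Perm (Fin s)
  connected : ∀ q q' : Fin s, ∃ g ∈ Subgroup.closure (Set.range glue), g q = q'

namespace PolycubeManifold

variable {d s : ℕ}

/-- The points: a cube and a position in that cube. The coordinates in a cube run over `[0,1)`,
and `UnitAddCircle` is `[0,1)` with its measure and with addition modulo `1`, so that of two glued
faces only the one with coordinate `0` is listed. -/
abbrev Point (_P : PolycubeManifold d s) : Type := Fin s × (Fin d → UnitAddCircle)

/-- Lebesgue measure, of total mass `s`. -/
noncomputable def measure (P : PolycubeManifold d s) : Measure P.Point :=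
  (Measure.count : Measure (Fin s)).prod (volume : Measure (Fin d → UnitAddCircle))

/-- The representative in `[0,1)` of a coordinate. -/
noncomputable def coord (x : UnitAddCircle) : ℝ := (AddCircle.equivIco (1 : ℝ) 0 x : ℝ)

/-- The straight line in `ℝ^d` from the position `x` in `[0,1)^d` with velocity `v`; the part with
`0 ≤ t ≤ 1` is the segment from `x` to `x + v`. -/
noncomputable def line (x : Fin d → UnitAddCircle) (v : Fin d → ℝ) (t : ℝ) : Fin d → ℝ :=
  fun i => coord (x i) + t * v i

/-- The cell of the integer grid of `ℝ^d` that contains the line at time `t`. -/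
noncomputable def cell (x : Fin d → UnitAddCircle) (v : Fin d → ℝ) (t : ℝ) : Fin d → ℤ :=
  fun i => ⌊line x v t i⌋

/-- The segment from `x` to `x + v` meets no face of codimension two or more of the grid
(for `d = 2`: no vertex), hence no singularity of the manifold. -/
def Nonsingular (x : Fin d → UnitAddCircle) (v : Fin d → ℝ) : Prop :=
  ∀ t ∈ Set.Icc (0 : ℝ) 1, ∀ i j : Fin d,
    (∃ m : ℤ, line x v t i = m) → (∃ n : ℤ, line x v t j = n) → i = j

/-- `c t` is the cube of `P` in which the geodesic segment that starts at `p` with velocity `v` is at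
time `t`, for `0 ≤ t ≤ 1`. While the unfolded geodesic stays in a cell the cube does not change,
and two cells that share the `i`-th face carry cubes that are glued along it. -/
structure IsItinerary (P : PolycubeManifold d s) (p : P.Point) (v : Fin d → ℝ)
    (c : ℝ → Fin s) : Prop where
  start : c 0 = p.1
  stay : ∀ t ∈ Set.Icc (0 : ℝ) 1, ∀ t' ∈ Set.Icc (0 : ℝ) 1,
    cell p.2 v t' = cell p.2 v t → c t' = c t
  cross : ∀ t ∈ Set.Icc (0 : ℝ) 1, ∀ t' ∈ Set.Icc (0 : ℝ) 1, ∀ i : Fin d,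
    cell p.2 v t' = cell p.2 v t + Pi.single i 1 → c t' = P.glue i (c t)

open Classical in
/-- The cube in which the geodesic segment that starts at `p` with velocity `v` ends at time `1`.
When the segment meets a face of codimension two (which happens for a null set of `p` only) the
geodesic need not exist, and the value is the label of the initial cube. -/
noncomputable def endCube (P : PolycubeManifold d s) (v : Fin d → ℝ) (p : P.Point) : Fin s :=
  if h : Nonsingular p.2 v ∧ ∃ c, P.IsItinerary p v c then h.2.choose 1 else p.1

/-- The `v`-shift: it moves a point along the geodesic in the direction of `v` by the length of
`v`. -/
noncomputable def shift (P : PolycubeManifold d s) (v : Fin d → ℝ) (p : P.Point) : P.Point :=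
  (P.endCube v p, fun i => p.2 i + ((v i : ℝ) : UnitAddCircle))

/-- The product of `P` with the unit torus `[0,1)`: one cube for every cube of `P`, with the last
pair of opposite faces of each cube identified with one another. -/
def prodCircle (P : PolycubeManifold d s) : PolycubeManifold (d + 1) s where
  pos := P.pos
  glue := Fin.snoc (α := fun _ => Equiv.Perm (Fin s)) P.glue 1
  connected := by
    intro q q'
    obtain ⟨g, hg, h⟩ := P.connected q q'
    refine ⟨g, Subgroup.closure_mono ?_ hg, h⟩
    rintro _ ⟨i, rfl⟩
    exact ⟨i.castSucc, by simp⟩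

end PolycubeManifold

/-- `v₁, …, v_d, 1` are linearly independent over `ℚ`. -/
def IsKroneckerVector {d : ℕ} (v : Fin d → ℝ) : Prop :=
  LinearIndependent ℚ (Fin.snoc (α := fun _ => ℝ) v 1 : Fin (d + 1) → ℝ)

/-! Outside a null set, the `w`-shift on the product is the direct product of the `v`-shift on `P`
with rotation of the circle by `w`. The `v`-shift is therefore a factor, and since some admissible
`w` exists, (ii) gives (i).

Conversely, expand the indicator of an invariant set of the product into Fourier series along the
circles. Its coefficients are bounded eigenfunctions of the `v`-shift whose eigenvalues are
characters at `w`. If all the non-trivial ones vanish, ergodicity of the `v`-shift makes the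
indicator constant (`Ergodic.prodMap_add_right`). They do vanish (`eigenfunction_ae_eq_zero`): the
`v`-shift is a skew product over a torus rotation that permutes the `s` cubes of each fibre
(`shift_eq`), so multiplying an eigenfunction over the fibre gives an eigenfunction of the rotation,
with the `s`-th power as eigenvalue. Eigenvalues of a rotation are characters at its vector, and
this would be an integer relation between the `v i`, `w` and `1`. -/

namespace PolycubeManifold

variable {d s : ℕ}

/-! ### Existence of itineraries -/

theorem single_one_injective {i j : Fin d}
    (h : (Pi.single i 1 : Fin d → ℤ) = Pi.single j 1) : i = j := by
  by_contra hij
  have := congrFun h i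
  simp [hij] at this

theorem not_add_single_add_single (a : Fin d → ℤ) (i j : Fin d) :
    ¬ a = a + Pi.single i 1 + Pi.single j 1 := by
  intro h
  have := congrFun h i
  by_cases hij : i = j
  · subst hij; simp at this; omega
  · simp [hij] at this

/-- Equal grid cells, or grid cells that share a face. -/
def CellsAdjacent (a b : Fin d → ℤ) : Prop :=
  b = a ∨ (∃ i, b = a + Pi.single i 1) ∨ ∃ i, a = b + Pi.single i 1

open Classical in
/-- The permutation of the cubes induced by moving from the grid cell `a` to the grid cell `b`
through their common face; it is trivial when there is none. -/
noncomputable def step (P : PolycubeManifold d s) (a b : Fin d → ℤ) : Equiv.Perm (Fin s) :=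
  if h : ∃ i, b = a + Pi.single i 1 then P.glue h.choose
  else if h : ∃ i, a = b + Pi.single i 1 then (P.glue h.choose)⁻¹ else 1

theorem step_add_single (P : PolycubeManifold d s) (a : Fin d → ℤ) (i : Fin d) :
    P.step a (a + Pi.single i 1) = P.glue i := by
  have h : ∃ j, a + Pi.single i 1 = a + Pi.single j (1 : ℤ) := ⟨i, rfl⟩
  rw [step, dif_pos h, ← single_one_injective (add_left_cancel h.choose_spec)]

theorem step_add_single_left (P : PolycubeManifold d s) (a : Fin d → ℤ) (i : Fin d) :
    P.step (a + Pi.single i 1) a = (P.glue i)⁻¹ := by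
  have h : ∃ j, a + Pi.single i 1 = a + Pi.single j (1 : ℤ) := ⟨i, rfl⟩
  have h' : ¬ ∃ j, a = a + Pi.single i 1 + Pi.single j (1 : ℤ) :=
    fun ⟨j, hj⟩ => not_add_single_add_single a i j hj
  rw [step, dif_neg h', dif_pos h, ← single_one_injective (add_left_cancel h.choose_spec)]

theorem step_self (P : PolycubeManifold d s) (a : Fin d → ℤ) : P.step a a = 1 := by
  have h' : ¬ ∃ j, a = a + Pi.single j (1 : ℤ) := by
    rintro ⟨j, hj⟩
    have := congrFun hj j
    simp at this
  rw [step, dif_neg h', dif_neg h']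

/-- The number of faces of the grid that the line crosses up to time `t`. -/
noncomputable def crossings (x : Fin d → UnitAddCircle) (v : Fin d → ℝ) (t : ℝ) : ℕ :=
  ∑ i, (cell x v t i - cell x v 0 i).natAbs

theorem cell_monotone (x : Fin d → UnitAddCircle) (v : Fin d → ℝ) (i : Fin d) :
    (∀ t t', t ≤ t' → cell x v t i ≤ cell x v t' i) ∨
      (∀ t t', t ≤ t' → cell x v t' i ≤ cell x v t i) := by
  rcases le_total 0 (v i) with h | h
  · refine Or.inl fun t t' ht => Int.floor_le_floor ?_
    simp only [line]; gcongr
  · refine Or.inr fun t t' ht => Int.floor_le_floor ?_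
    simp only [line]
    linarith [mul_le_mul_of_nonpos_right ht h]

/-- Each coordinate moves monotonically, so every summand of `crossings` is nondecreasing in time;
equal sums force equal summands. -/
theorem cell_eq_of_crossings_eq {x : Fin d → UnitAddCircle} {v : Fin d → ℝ} {t t' : ℝ}
    (ht : 0 ≤ t) (ht' : 0 ≤ t') (h : crossings x v t = crossings x v t') :
    cell x v t = cell x v t' := by
  wlog htt : t ≤ t' generalizing t t'
  · exact (this ht' ht h.symm (le_of_not_ge htt)).symm
  have key := (Finset.sum_eq_sum_iff_of_le (s := Finset.univ)
    (f := fun i => (cell x v t i - cell x v 0 i).natAbs)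
    (g := fun i => (cell x v t' i - cell x v 0 i).natAbs) (fun i _ => by
      rcases cell_monotone x v i with m | m
      · have := m 0 t ht; have := m t t' htt; omega
      · have := m 0 t ht; have := m t t' htt; omega)).1 h
  funext i
  have := key i (Finset.mem_univ i)
  rcases cell_monotone x v i with m | m
  · have := m 0 t ht; have := m t t' htt; omega
  · have := m 0 t ht; have := m t t' htt; omega

theorem crossings_of_cell_eq_add_single {x : Fin d → UnitAddCircle} {v : Fin d → ℝ} {t t' : ℝ}
    (ht : 0 ≤ t) (ht' : 0 ≤ t') {i : Fin d} (h : cell x v t' = cell x v t + Pi.single i 1) :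
    crossings x v t' = crossings x v t + 1 ∨ crossings x v t = crossings x v t' + 1 := by
  have hi : cell x v t' i = cell x v t i + 1 := by simp [h]
  have hr : ∑ j ∈ Finset.univ.erase i, (cell x v t' j - cell x v 0 j).natAbs =
      ∑ j ∈ Finset.univ.erase i, (cell x v t j - cell x v 0 j).natAbs := by
    refine Finset.sum_congr rfl fun j hj => ?_
    rw [h, Pi.add_apply, Pi.single_eq_of_ne (Finset.ne_of_mem_erase hj), add_zero]
  rw [crossings, crossings, ← Finset.add_sum_erase _ _ (Finset.mem_univ i),
    ← Finset.add_sum_erase _ _ (Finset.mem_univ i), hr]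
  rcases cell_monotone x v i with m | m
  · have := m 0 t ht; have := m 0 t' ht'; omega
  · have := m 0 t ht; have := m 0 t' ht'; omega

open Classical in
/-- A time at which `n` faces have been crossed, if there is one. -/
noncomputable def crossingTime (x : Fin d → UnitAddCircle) (v : Fin d → ℝ) (n : ℕ) : ℝ :=
  if h : ∃ t, 0 ≤ t ∧ crossings x v t = n then h.choose else 0

theorem cell_crossingTime (x : Fin d → UnitAddCircle) (v : Fin d → ℝ) {t : ℝ} (ht : 0 ≤ t) :
    cell x v (crossingTime x v (crossings x v t)) = cell x v t := by
  have h : ∃ t', 0 ≤ t' ∧ crossings x v t' = crossings x v t := ⟨t, ht, rfl⟩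
  rw [crossingTime, dif_pos h]
  exact cell_eq_of_crossings_eq h.choose_spec.1 ht h.choose_spec.2

/-- The permutation of the cubes induced by the first `n` crossings. -/
noncomputable def holonomy (P : PolycubeManifold d s) (x : Fin d → UnitAddCircle)
    (v : Fin d → ℝ) : ℕ → Equiv.Perm (Fin s)
  | 0 => 1
  | n + 1 => P.step (cell x v (crossingTime x v n)) (cell x v (crossingTime x v (n + 1))) *
      holonomy P x v n

/-- The cube can be defined through the crossing count because the count determines the cell.
Nonsingularity is not needed: through a face of higher codimension the count jumps, and the
itinerary conditions only compare times whose counts are equal or consecutive, so the default at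
skipped counts is harmless. -/
theorem exists_isItinerary (P : PolycubeManifold d s) (p : P.Point) (v : Fin d → ℝ) :
    ∃ c, P.IsItinerary p v c := by
  refine ⟨fun t => P.holonomy p.2 v (crossings p.2 v t) p.1, ⟨?_, ?_, ?_⟩⟩
  · simp [crossings, holonomy]
  · intro t _ t' _ h
    simp [crossings, h]
  · intro t ht t' ht' i h
    have e := cell_crossingTime p.2 v ht.1
    have e' := cell_crossingTime p.2 v ht'.1
    rcases crossings_of_cell_eq_add_single ht.1 ht'.1 h with hn | hn
    · rw [hn] at e' ⊢
      rw [holonomy, e, e', h, step_add_single, Equiv.Perm.mul_apply]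
    · rw [hn] at e ⊢
      rw [holonomy, e, e', h, step_add_single_left]
      simp

/-! ### Uniqueness of the end cube; the shift as a skew product -/

theorem IsItinerary.apply_eq_step {P : PolycubeManifold d s} {p : P.Point} {v : Fin d → ℝ}
    {c : ℝ → Fin s} (hc : P.IsItinerary p v c) {t t' : ℝ} (ht : t ∈ Set.Icc (0 : ℝ) 1)
    (ht' : t' ∈ Set.Icc (0 : ℝ) 1) (h : CellsAdjacent (cell p.2 v t) (cell p.2 v t')) :
    c t' = P.step (cell p.2 v t) (cell p.2 v t') (c t) := by
  rcases h with h | ⟨i, h⟩ | ⟨i, h⟩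
  · rw [hc.stay t ht t' ht' h, h, step_self, Equiv.Perm.one_apply]
  · rw [hc.cross t ht t' ht' i h, h, step_add_single]
  · rw [hc.cross t' ht' t ht i h, h, step_add_single_left]
    simp

/-- The permutation induced by the first `k` steps along the segment sampled at the multiples
of `1 / n`. -/
noncomputable def sampledHolonomy (P : PolycubeManifold d s) (x : Fin d → UnitAddCircle)
    (v : Fin d → ℝ) (n : ℕ) : ℕ → Equiv.Perm (Fin s)
  | 0 => 1
  | k + 1 => P.step (cell x v (k / n)) (cell x v ((k + 1 : ℕ) / n)) * sampledHolonomy P x v n k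

/-- Sampling at the multiples of `1 / n` sees the crossings of faces one at a time. -/
def FineSampling (x : Fin d → UnitAddCircle) (v : Fin d → ℝ) (n : ℕ) : Prop :=
  0 < n ∧ ∀ k < n, CellsAdjacent (cell x v (k / n)) (cell x v ((k + 1 : ℕ) / n))

/-- The right side does not mention `c`, so the choice of itinerary in `endCube` is immaterial. -/
theorem IsItinerary.apply_one {P : PolycubeManifold d s} {p : P.Point} {v : Fin d → ℝ}
    {c : ℝ → Fin s} (hc : P.IsItinerary p v c) {n : ℕ} (hn : FineSampling p.2 v n) :
    c 1 = P.sampledHolonomy p.2 v n n p.1 := by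
  have hpos : (0 : ℝ) < n := by exact_mod_cast hn.1
  have hmem : ∀ k ≤ n, (k : ℝ) / n ∈ Set.Icc (0 : ℝ) 1 := fun k hk =>
    ⟨by positivity, by rw [div_le_one hpos]; exact_mod_cast hk⟩
  have key : ∀ k ≤ n, c (k / n) = P.sampledHolonomy p.2 v n k p.1 := by
    intro k
    induction k with
    | zero => intro _; simp [sampledHolonomy, hc.start]
    | succ k ih =>
      intro hk
      rw [hc.apply_eq_step (hmem k (by omega)) (hmem (k + 1) hk) (hn.2 k (by omega)),
        ih (by omega), sampledHolonomy, Equiv.Perm.mul_apply]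
  simpa [hpos.ne'] using key n le_rfl

theorem eventually_floor_eq_of_not_int {f : ℝ → ℝ} {t : ℝ} (hf : ContinuousAt f t)
    (h : ¬ ∃ m : ℤ, f t = m) : ∀ᶠ t' in nhds t, ⌊f t'⌋ = ⌊f t⌋ := by
  have h1 : (⌊f t⌋ : ℝ) < f t :=
    lt_of_le_of_ne (Int.floor_le _) fun he => h ⟨_, he.symm⟩
  filter_upwards [hf.tendsto.eventually_const_lt h1, hf.tendsto.eventually_lt_const (Int.lt_floor_add_one (f t))]
    with t' h2 h3
  exact Int.floor_eq_iff.2 ⟨h2.le, h3⟩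

theorem eventually_floor_mem_of_int {f : ℝ → ℝ} {t : ℝ} (hf : ContinuousAt f t) {m : ℤ}
    (h : f t = m) : ∀ᶠ t' in nhds t, ⌊f t'⌋ = m ∨ ⌊f t'⌋ = m - 1 := by
  filter_upwards [hf.tendsto.eventually_const_lt (show (m : ℝ) - 1 < f t by rw [h]; linarith),
    hf.tendsto.eventually_lt_const (show f t < (m : ℝ) + 1 by rw [h]; linarith)] with t' h2 h3
  rcases le_or_gt (m : ℝ) (f t') with h4 | h4
  · exact Or.inl (Int.floor_eq_iff.2 ⟨h4, h3⟩)
  · refine Or.inr (Int.floor_eq_iff.2 ⟨?_, ?_⟩) <;> push_cast <;> linarith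

theorem continuous_line (x : Fin d → UnitAddCircle) (v : Fin d → ℝ) (i : Fin d) :
    Continuous fun t => line x v t i := by
  unfold line; fun_prop

theorem cellsAdjacent_of_forall_ne {a b : Fin d → ℤ} {i : Fin d} {m : ℤ}
    (h : ∀ j ≠ i, b j = a j) (ha : a i = m ∨ a i = m - 1) (hb : b i = m ∨ b i = m - 1) :
    CellsAdjacent a b := by
  have hext : ∀ {a b : Fin d → ℤ}, (∀ j ≠ i, b j = a j) → b i = a i + 1 →
      b = a + Pi.single i 1 := by
    intro a b h h'
    funext j
    by_cases hj : j = i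
    · subst hj; simp [h']
    · simp [hj, h j hj]
  rcases ha with ha | ha <;> rcases hb with hb | hb
  · refine Or.inl (funext fun j => ?_)
    by_cases hj : j = i
    · subst hj; rw [ha, hb]
    · exact h j hj
  · exact Or.inr (Or.inr ⟨i, hext (fun j hj => (h j hj).symm) (by omega)⟩)
  · exact Or.inr (Or.inl ⟨i, hext h (by omega)⟩)
  · refine Or.inl (funext fun j => ?_)
    by_cases hj : j = i
    · subst hj; rw [ha, hb]
    · exact h j hj

/-- At most one coordinate is an integer at time `t`. The floors of the others are locally constant,
and its own floor takes only two neighbouring values nearby. -/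
theorem Nonsingular.exists_isOpen_cellsAdjacent {x : Fin d → UnitAddCircle} {v : Fin d → ℝ}
    (hx : Nonsingular x v) {t : ℝ} (ht : t ∈ Set.Icc (0 : ℝ) 1) :
    ∃ U : Set ℝ, IsOpen U ∧ t ∈ U ∧
      ∀ t₁ ∈ U, ∀ t₂ ∈ U, CellsAdjacent (cell x v t₁) (cell x v t₂) := by
  by_cases h : ∃ i, ∃ m : ℤ, line x v t i = m
  · obtain ⟨i, m, him⟩ := h
    have h1 : ∀ᶠ t' in nhds t, ∀ j, j ≠ i → cell x v t' j = cell x v t j := by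
      rw [Filter.eventually_all]
      intro j
      by_cases hj : j = i
      · simp [hj]
      · filter_upwards [eventually_floor_eq_of_not_int (continuous_line x v j).continuousAt
          (fun hm => hj (hx t ht j i hm ⟨m, him⟩))] with t' ht' _
        exact ht'
    have h2 := eventually_floor_mem_of_int (continuous_line x v i).continuousAt him
    obtain ⟨U, hU, hUo, htU⟩ := eventually_nhds_iff.1 (h1.and h2)
    exact ⟨U, hUo, htU, fun t₁ h₁ t₂ h₂ => cellsAdjacent_of_forall_ne
      (fun j hj => ((hU t₂ h₂).1 j hj).trans ((hU t₁ h₁).1 j hj).symm) (hU t₁ h₁).2 (hU t₂ h₂).2⟩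
  · push Not at h
    have h1 : ∀ᶠ t' in nhds t, ∀ j, cell x v t' j = cell x v t j := by
      rw [Filter.eventually_all]
      exact fun j => eventually_floor_eq_of_not_int (continuous_line x v j).continuousAt
        (fun ⟨m, hm⟩ => h j m hm)
    obtain ⟨U, hU, hUo, htU⟩ := eventually_nhds_iff.1 h1
    exact ⟨U, hUo, htU, fun t₁ h₁ t₂ h₂ => Or.inl
      (funext fun j => (hU t₂ h₂ j).trans (hU t₁ h₁ j).symm)⟩

theorem Nonsingular.exists_fineSampling {x : Fin d → UnitAddCircle} {v : Fin d → ℝ}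
    (hx : Nonsingular x v) : ∃ n, FineSampling x v n := by
  choose! U hUo hU hadj using fun t ht => hx.exists_isOpen_cellsAdjacent (t := t) ht
  -- A mesh below the Lebesgue number puts consecutive sample times into one of the sets `U t`.
  obtain ⟨δ, hδ, hleb⟩ := lebesgue_number_lemma_of_metric (isCompact_Icc (a := (0 : ℝ)) (b := 1))
    (c := fun t : Set.Icc (0 : ℝ) 1 => U t) (fun t => hUo t t.2)
    (fun t ht => Set.mem_iUnion.2 ⟨⟨t, ht⟩, hU t ht⟩)
  obtain ⟨m, hm⟩ := exists_nat_one_div_lt hδ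
  refine ⟨m + 1, Nat.succ_pos _, fun k hk => ?_⟩
  have hpos : (0 : ℝ) < ((m + 1 : ℕ) : ℝ) := by positivity
  have hmem : (k : ℝ) / (m + 1 : ℕ) ∈ Set.Icc (0 : ℝ) 1 :=
    ⟨by positivity, by rw [div_le_one hpos]; exact_mod_cast hk.le⟩
  obtain ⟨t, ht⟩ := hleb _ hmem
  refine hadj t t.2 _ (ht (Metric.mem_ball_self hδ)) _ (ht ?_)
  rw [Metric.mem_ball, Real.dist_eq, ← sub_div]
  push_cast
  rw [add_sub_cancel_left, abs_of_pos (by positivity)]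
  exact hm

open Classical in
/-- The permutation of the cubes that the segment from `x` to `x + v` induces. -/
noncomputable def cocycle (P : PolycubeManifold d s) (v : Fin d → ℝ) (x : Fin d → UnitAddCircle) :
    Equiv.Perm (Fin s) :=
  if h : Nonsingular x v then
    P.sampledHolonomy x v (Nat.find h.exists_fineSampling) (Nat.find h.exists_fineSampling)
  else 1

theorem endCube_eq_of_isItinerary {P : PolycubeManifold d s} {p : P.Point} {v : Fin d → ℝ}
    {c : ℝ → Fin s} (hp : Nonsingular p.2 v) (hc : P.IsItinerary p v c) :
    P.endCube v p = c 1 := by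
  obtain ⟨n, hn⟩ := hp.exists_fineSampling
  have h : Nonsingular p.2 v ∧ ∃ c, P.IsItinerary p v c := ⟨hp, c, hc⟩
  rw [endCube, dif_pos h, h.2.choose_spec.apply_one hn, hc.apply_one hn]

theorem endCube_eq_cocycle (P : PolycubeManifold d s) (v : Fin d → ℝ) (p : P.Point) :
    P.endCube v p = P.cocycle v p.2 p.1 := by
  classical
  by_cases hp : Nonsingular p.2 v
  · obtain ⟨c, hc⟩ := P.exists_isItinerary p v
    rw [endCube_eq_of_isItinerary hp hc, cocycle, dif_pos hp]
    exact hc.apply_one (Nat.find_spec hp.exists_fineSampling)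
  · rw [endCube, dif_neg (fun h => hp h.1), cocycle, dif_neg hp, Equiv.Perm.one_apply]

/-- The permutation depends on the position only, not on the starting cube. -/
theorem shift_eq (P : PolycubeManifold d s) (v : Fin d → ℝ) (p : P.Point) :
    P.shift v p = (P.cocycle v p.2 p.1, p.2 + fun i => ((v i : ℝ) : UnitAddCircle)) := by
  rw [shift, endCube_eq_cocycle]; rfl

end PolycubeManifold

/-! ### Measurability and invariance of Lebesgue measure -/

instance unitAddCircle_isProbabilityMeasure :
    IsProbabilityMeasure (volume : Measure UnitAddCircle) :=
  ⟨by rw [AddCircle.measure_univ, ENNReal.ofReal_one]⟩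

instance unitAddCircle_nullSingletonClass :
    NullSingletonClass (volume : Measure UnitAddCircle) := by
  refine ⟨fun x => le_antisymm (ge_of_tendsto' (f := fun n : ℕ => ENNReal.ofReal (2 * (1 / (n + 1))))
    (x := Filter.atTop) ?_ fun n => ?_) zero_le⟩
  · rw [← ENNReal.ofReal_zero]
    refine ENNReal.tendsto_ofReal ?_
    simpa using tendsto_one_div_add_atTop_nhds_zero_nat.const_mul (2 : ℝ)
  · refine (measure_mono (Set.singleton_subset_iff.2
      (Metric.mem_closedBall_self (by positivity : (0 : ℝ) ≤ 1 / (n + 1))))).trans ?_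
    rw [AddCircle.volume_closedBall]
    exact ENNReal.ofReal_le_ofReal (min_le_right _ _)

namespace PolycubeManifold

variable {d s : ℕ}

instance (P : PolycubeManifold d s) : IsFiniteMeasure P.measure := by
  unfold measure; infer_instance

theorem coe_coord (x : UnitAddCircle) : ((coord x : ℝ) : UnitAddCircle) = x :=
  (AddCircle.equivIco (1 : ℝ) 0).left_inv x

theorem measurable_coord : Measurable coord :=
  measurable_subtype_coe.comp (AddCircle.measurableEquivIco (1 : ℝ) 0).measurable

theorem measurable_cell (v : Fin d → ℝ) (t : ℝ) : Measurable fun x => cell x v t := by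
  refine measurable_pi_lambda _ fun i => ?_
  exact Int.measurable_floor.comp
    ((measurable_coord.comp (measurable_pi_apply i)).add_const (t * v i))

theorem line_eq_int_iff (x : Fin d → UnitAddCircle) (v : Fin d → ℝ) (t : ℝ) (i : Fin d) :
    (∃ m : ℤ, line x v t i = m) ↔ x i + ((t * v i : ℝ) : UnitAddCircle) = 0 := by
  have : x i + ((t * v i : ℝ) : UnitAddCircle) = ((line x v t i : ℝ) : UnitAddCircle) := by
    rw [line, AddCircle.coe_add, coe_coord]
  rw [this, AddCircle.coe_eq_zero_iff]
  simp [eq_comm]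

/-- Written as equations in the circle, the conditions are closed in time and position jointly, and
projecting away the compact time interval is a closed map. -/
theorem isClosed_setOf_meets_codim_two (v : Fin d → ℝ) (i j : Fin d) :
    IsClosed {x : Fin d → UnitAddCircle | ∃ t ∈ Set.Icc (0 : ℝ) 1,
      (∃ m : ℤ, line x v t i = m) ∧ ∃ n : ℤ, line x v t j = n} := by
  have hc : ∀ k : Fin d, Continuous fun y : Set.Icc (0 : ℝ) 1 × (Fin d → UnitAddCircle) =>
      y.2 k + (((y.1 : ℝ) * v k : ℝ) : UnitAddCircle) := fun k =>
    ((continuous_apply k).comp continuous_snd).add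
      ((AddCircle.continuous_mk' (1 : ℝ)).comp
        ((continuous_subtype_val.comp continuous_fst).mul continuous_const))
  have hK : IsClosed {y : Set.Icc (0 : ℝ) 1 × (Fin d → UnitAddCircle) |
      y.2 i + (((y.1 : ℝ) * v i : ℝ) : UnitAddCircle) = 0 ∧
      y.2 j + (((y.1 : ℝ) * v j : ℝ) : UnitAddCircle) = 0} :=
    (isClosed_eq (hc i) continuous_const).inter (isClosed_eq (hc j) continuous_const)
  convert isClosedMap_snd_of_compactSpace _ hK using 1
  ext x
  simp only [line_eq_int_iff, Set.mem_ofPred_eq, Set.mem_image, Prod.exists, exists_and_right,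
    exists_eq_right, Subtype.exists, exists_prop]
  exact exists_congr fun _ => and_assoc.symm

theorem setOf_nonsingular (v : Fin d → ℝ) : {x | Nonsingular x v} =
    ⋂ i, ⋂ j, ⋂ (_ : i ≠ j), {x : Fin d → UnitAddCircle | ∃ t ∈ Set.Icc (0 : ℝ) 1,
      (∃ m : ℤ, line x v t i = m) ∧ ∃ n : ℤ, line x v t j = n}ᶜ := by
  ext x
  simp only [Set.mem_iInter, Set.mem_compl_iff, Set.mem_ofPred_eq, Nonsingular]
  constructor
  · rintro h i j hij ⟨t, ht, hi, hj⟩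
    exact hij (h t ht i j hi hj)
  · intro h t ht i j hi hj
    by_contra hij
    exact h i j hij ⟨t, ht, hi, hj⟩

theorem measurableSet_nonsingular (v : Fin d → ℝ) :
    MeasurableSet {x : Fin d → UnitAddCircle | Nonsingular x v} := by
  rw [setOf_nonsingular]
  exact MeasurableSet.iInter fun i => MeasurableSet.iInter fun j => MeasurableSet.iInter fun _ =>
    (isClosed_setOf_meets_codim_two v i j).measurableSet.compl

theorem volume_setOf_apply_eq {i j : Fin d} (hij : i ≠ j) {f : UnitAddCircle → UnitAddCircle}
    (hf : Measurable f) : volume {x : Fin d → UnitAddCircle | x i = f (x j)} = 0 := by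
  cases d with
  | zero => exact i.elim0
  | succ n =>
    obtain ⟨k, rfl⟩ := Fin.exists_succAbove_eq hij.symm
    have hmp := volume_preserving_piFinSuccAbove (fun _ : Fin (n + 1) => UnitAddCircle) i
    have hS : MeasurableSet {y : UnitAddCircle × (Fin n → UnitAddCircle) | y.1 = f (y.2 k)} :=
      measurableSet_eq_fun measurable_fst
        (hf.comp ((measurable_pi_apply k).comp measurable_snd))
    have h0 : volume {y : UnitAddCircle × (Fin n → UnitAddCircle) | y.1 = f (y.2 k)} = 0 := by
      rw [Measure.volume_eq_prod, Measure.prod_apply_symm hS, lintegral_eq_zero_iff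
        (measurable_measure_prodMk_right hS)]
      refine Filter.Eventually.of_forall fun y => ?_
      exact measure_singleton (f (y k))
    rw [← hmp.measure_preimage hS.nullMeasurableSet] at h0
    exact h0

/-- The time at which coordinate `j` reaches the integer `n` is a function of `x j`; if coordinate
`i` is an integer at that time, then `x i` is a function of `x j`. The bad set thus lies in
countably many null graphs. -/
theorem ae_nonsingular {v : Fin d → ℝ} (hv : ∀ i, v i ≠ 0) :
    ∀ᵐ x : Fin d → UnitAddCircle, Nonsingular x v := by
  change {x | Nonsingular x v} ∈ ae volume
  rw [setOf_nonsingular]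
  refine Filter.iInter_mem.2 fun i => Filter.iInter_mem.2 fun j => Filter.iInter_mem.2 fun hij => ?_
  rw [compl_mem_ae_iff]
  refine measure_mono_null (t := ⋃ n : ℤ, {x : Fin d → UnitAddCircle |
    x i = (fun y : UnitAddCircle => ((-((n - coord y) / v j * v i) : ℝ) : UnitAddCircle)) (x j)})
    ?_ (measure_iUnion_null fun n => volume_setOf_apply_eq hij (f := fun y : UnitAddCircle =>
      ((-((n - coord y) / v j * v i) : ℝ) : UnitAddCircle)) ?_)
  · rintro x ⟨t, -, hi, n, hn⟩
    rw [line_eq_int_iff] at hi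
    have ht : t = (n - coord (x j)) / v j := by
      rw [eq_div_iff (hv j), ← hn, line]; ring
    refine Set.mem_iUnion.2 ⟨n, ?_⟩
    change x i = ((-((n - coord (x j)) / v j * v i) : ℝ) : UnitAddCircle)
    rw [← ht, AddCircle.coe_neg]
    exact eq_neg_of_add_eq_zero_left hi
  · exact AddCircle.measurable_mk'.comp
      ((((measurable_const.sub measurable_coord).div_const _).mul_const _).neg)

theorem measurable_sampledHolonomy (P : PolycubeManifold d s) (v : Fin d → ℝ) (n k : ℕ)
    (q : Fin s) : Measurable fun x => P.sampledHolonomy x v n k q := by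
  induction k with
  | zero => exact measurable_const
  | succ k ih =>
    exact (Measurable.of_discrete (f := fun y : ((Fin d → ℤ) × (Fin d → ℤ)) × Fin s =>
      P.step y.1.1 y.1.2 y.2)).comp
        (((measurable_cell v _).prodMk (measurable_cell v _)).prodMk ih)

theorem measurableSet_fineSampling (v : Fin d → ℝ) (n : ℕ) :
    MeasurableSet {x : Fin d → UnitAddCircle | FineSampling x v n} := by
  have : {x : Fin d → UnitAddCircle | FineSampling x v n} = {_x | 0 < n} ∩ ⋂ k, ⋂ (_ : k < n),
      {x | CellsAdjacent (cell x v (k / n)) (cell x v ((k + 1 : ℕ) / n))} := by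
    ext x
    simp [FineSampling]
  rw [this]
  refine (MeasurableSet.const _).inter (MeasurableSet.iInter fun k => MeasurableSet.iInter
    fun _ => ?_)
  exact ((measurable_cell v _).prodMk (measurable_cell v _)) (MeasurableSet.of_discrete
    (s := {y : (Fin d → ℤ) × (Fin d → ℤ) | CellsAdjacent y.1 y.2}))

/-- Replaces the least sampling rate by any fine one, which exhibits the level sets as countable
unions of measurable sets. -/
theorem cocycle_apply_eq_iff (P : PolycubeManifold d s) (v : Fin d → ℝ)
    (x : Fin d → UnitAddCircle) (q r : Fin s) : P.cocycle v x q = r ↔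
      (∃ n, Nonsingular x v ∧ FineSampling x v n ∧ P.sampledHolonomy x v n n q = r) ∨
        (¬ Nonsingular x v ∧ q = r) := by
  by_cases hx : Nonsingular x v
  · obtain ⟨c, hc⟩ := P.exists_isItinerary (q, x) v
    have h : P.cocycle v x q = c 1 :=
      (P.endCube_eq_cocycle v (q, x)).symm.trans (endCube_eq_of_isItinerary hx hc)
    rw [h]
    constructor
    · rintro rfl
      obtain ⟨n, hn⟩ := hx.exists_fineSampling
      exact Or.inl ⟨n, hx, hn, (hc.apply_one hn).symm⟩
    · rintro (⟨n, -, hn, rfl⟩ | h)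
      · exact hc.apply_one hn
      · exact (h.1 hx).elim
  · simp [hx, cocycle]

theorem measurable_cocycle (P : PolycubeManifold d s) (v : Fin d → ℝ) (q : Fin s) :
    Measurable fun x => P.cocycle v x q := by
  refine measurable_to_countable' fun r => ?_
  have : (fun x => P.cocycle v x q) ⁻¹' {r} =
      (⋃ n, {x | Nonsingular x v} ∩ ({x | FineSampling x v n} ∩
        (fun x => P.sampledHolonomy x v n n q) ⁻¹' {r})) ∪ ({x | Nonsingular x v}ᶜ ∩ {_x | q = r}) := by
    ext x
    simp [cocycle_apply_eq_iff]
  rw [this]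
  exact (MeasurableSet.iUnion fun n => (measurableSet_nonsingular v).inter
    ((measurableSet_fineSampling v n).inter
      (measurable_sampledHolonomy P v n n q (measurableSet_singleton r)))).union
    ((measurableSet_nonsingular v).compl.inter (MeasurableSet.const _))

theorem map_count_perm (e : Equiv.Perm (Fin s)) :
    (Measure.count : Measure (Fin s)).map e = Measure.count := by
  ext A hA
  rw [Measure.map_apply Measurable.of_discrete hA, Measure.count_apply hA,
    Measure.count_apply (Measurable.of_discrete hA), Set.encard_preimage_of_bijective e.bijective]

theorem measurePreserving_shift (P : PolycubeManifold d s) (v : Fin d → ℝ) :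
    MeasurePreserving (P.shift v) P.measure P.measure := by
  have hskew := (measurePreserving_add_right (volume : Measure (Fin d → UnitAddCircle))
    (fun i => ((v i : ℝ) : UnitAddCircle))).skew_product
    (μc := (Measure.count : Measure (Fin s))) (μd := Measure.count)
    (g := fun x q => P.cocycle v x q)
    (measurable_from_prod_countable_left fun q => P.measurable_cocycle v q)
    (Filter.Eventually.of_forall fun x => map_count_perm _)
  -- `skew_product` has the base as first factor, whereas in `Point` the base is second.
  have := (Measure.measurePreserving_swap.comp hskew).comp
    (Measure.measurePreserving_swap (μ := (Measure.count : Measure (Fin s)))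
      (ν := (volume : Measure (Fin d → UnitAddCircle))))
  rw [show P.shift v = _ from funext fun p => P.shift_eq v p]
  exact this

end PolycubeManifold

/-! ### Fourier series and eigenfunctions -/

theorem Ergodic.congr_ae {α : Type*} [MeasurableSpace α] {μ : Measure α} {f g : α → α}
    (hf : Ergodic f μ) (hg : MeasurePreserving g μ μ) (h : f =ᵐ[μ] g) : Ergodic g μ := by
  refine ⟨hg, ⟨fun A hA hgA => ?_⟩⟩
  refine hf.quasiErgodic.aeconst_set₀ hA.nullMeasurableSet ?_
  conv_rhs => rw [← hgA]
  filter_upwards [h] with x hx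
  exact congrArg A hx

theorem volume_unitAddCircle_eq_haar :
    (volume : Measure UnitAddCircle) = AddCircle.haarAddCircle := by
  rw [AddCircle.volume_eq_smul_haarAddCircle, ENNReal.ofReal_one, one_smul]

theorem ae_eq_zero_of_integral_fourier_eq_zero {f : UnitAddCircle → ℂ} {C : ℝ}
    (hf : Measurable f) (hC : ∀ x, ‖f x‖ ≤ C)
    (h : ∀ k : ℤ, ∫ z, fourier (-k) z * f z = 0) : f =ᵐ[volume] 0 := by
  rw [volume_unitAddCircle_eq_haar] at h ⊢
  have hL : MemLp f 2 AddCircle.haarAddCircle :=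
    MemLp.of_bound hf.aestronglyMeasurable C (Filter.Eventually.of_forall hC)
  have h0 : hL.toLp f = 0 := by
    apply (fourierBasis (T := 1)).repr.injective
    ext k
    rw [fourierBasis_repr, map_zero, fourierCoeff_congr_ae hL.coeFn_toLp]
    exact h k
  exact hL.coeFn_toLp.symm.trans (h0 ▸ Lp.coeFn_zero _ _ _)

theorem ae_eq_zero_of_integral_mFourier_eq_zero {d : ℕ} {f : (Fin d → UnitAddCircle) → ℂ} {C : ℝ}
    (hf : Measurable f) (hC : ∀ x, ‖f x‖ ≤ C)
    (h : ∀ m : Fin d → ℤ, ∫ x, UnitAddTorus.mFourier (-m) x * f x = 0) : f =ᵐ[volume] 0 := by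
  have hvol : (volume : Measure (Fin d → UnitAddCircle)) =
      Measure.pi fun _ => AddCircle.haarAddCircle := by
    rw [volume_pi, volume_unitAddCircle_eq_haar]
  rw [hvol] at h ⊢
  have hL : MemLp f 2 (Measure.pi fun _ => AddCircle.haarAddCircle) :=
    MemLp.of_bound hf.aestronglyMeasurable C (Filter.Eventually.of_forall hC)
  have h0 : hL.toLp f = 0 := by
    apply (UnitAddTorus.mFourierBasis (d := Fin d)).repr.injective
    ext m
    rw [map_zero]
    refine (UnitAddTorus.mFourierBasis_repr _ m).trans ?_
    refine Eq.trans ?_ (h m)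
    refine integral_congr_ae ?_
    filter_upwards [hL.coeFn_toLp] with x hx
    exact congrArg (UnitAddTorus.mFourier (-m) x * ·) hx
  exact hL.coeFn_toLp.symm.trans (h0 ▸ Lp.coeFn_zero _ _ _)

theorem fourier_apply_add {T : ℝ} (k : ℤ) (x y : AddCircle T) :
    fourier k (x + y) = fourier k x * fourier k y := by
  simp [fourier_apply, AddCircle.toCircle_add]

theorem mFourier_apply_add {d : ℕ} (m : Fin d → ℤ) (x y : Fin d → UnitAddCircle) :
    UnitAddTorus.mFourier m (x + y) = UnitAddTorus.mFourier m x * UnitAddTorus.mFourier m y := by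
  simp only [UnitAddTorus.mFourier, ContinuousMap.coe_mk, Pi.add_apply, fourier_apply_add,
    Finset.prod_mul_distrib]

/-- Translating the integral by `a` multiplies the `m`-th Fourier coefficient by `mFourier (-m) a *
l`, so it vanishes unless this factor is `1`; and some coefficient is nonzero. -/
theorem exists_mFourier_eq_of_eigenfunction {d : ℕ} {F : (Fin d → UnitAddCircle) → ℂ} {C : ℝ}
    (hF : Measurable F) (hC : ∀ x, ‖F x‖ ≤ C) (h0 : ¬ F =ᵐ[volume] 0) {a : Fin d → UnitAddCircle}
    {l : ℂ} (ha : ∀ x, F (x + a) = l * F x) : ∃ m, UnitAddTorus.mFourier m a = l := by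
  by_contra! hne
  refine h0 (ae_eq_zero_of_integral_mFourier_eq_zero hF hC fun m => ?_)
  have key : ∫ x, UnitAddTorus.mFourier (-m) x * F x =
      (UnitAddTorus.mFourier (-m) a * l) * ∫ x, UnitAddTorus.mFourier (-m) x * F x := by
    conv_lhs => rw [← integral_add_right_eq_self _ a]
    rw [← integral_const_mul]
    refine integral_congr_ae (Filter.Eventually.of_forall fun x => ?_)
    simp only [mFourier_apply_add, ha]
    ring
  by_contra hI
  have h1 : UnitAddTorus.mFourier (-m) a * l = 1 := by
    have := mul_right_cancel₀ hI ((one_mul _).trans key)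
    exact this.symm
  have h2 : UnitAddTorus.mFourier m a * UnitAddTorus.mFourier (-m) a = 1 := by
    rw [← UnitAddTorus.mFourier_add, add_neg_cancel, UnitAddTorus.mFourier_zero]
    rfl
  refine hne m ?_
  calc _ = UnitAddTorus.mFourier m a * (UnitAddTorus.mFourier (-m) a * l) := by rw [h1, mul_one]
    _ = l := by rw [← mul_assoc, h2, one_mul]

theorem norm_fourier_apply {T : ℝ} (k : ℤ) (x : AddCircle T) : ‖fourier k x‖ = 1 := by
  rw [fourier_apply, Circle.norm_coe]

/-- The product of an ergodic map with a rotation of the circle is ergodic if no non-trivial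
character value at the rotation is an eigenvalue of the map. -/
theorem Ergodic.prodMap_add_right {X : Type*} [MeasurableSpace X] {μ : Measure X} [IsFiniteMeasure μ]
    {T : X → X} (hT : Ergodic T μ) {w : UnitAddCircle}
    (hw : ∀ k : ℤ, k ≠ 0 → ∀ g : X → ℂ, Measurable g → (∀ p, ‖g p‖ ≤ 1) →
      (∀ p, g (T p) = fourier k w * g p) → g =ᵐ[μ] 0) :
    Ergodic (Prod.map T (· + w)) (μ.prod (volume : Measure UnitAddCircle)) := by
  refine ⟨hT.toMeasurePreserving.prod (measurePreserving_add_right _ w), ⟨fun A hA hTA => ?_⟩⟩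
  set h : X × UnitAddCircle → ℂ := A.indicator 1 with hh
  have hm : Measurable h := measurable_one.indicator hA
  have hle : ∀ y, ‖h y‖ ≤ 1 := fun y => by
    by_cases hy : y ∈ A <;> simp [hh, hy]
  have hinv : ∀ p z, h (T p, z + w) = h (p, z) := fun p z => by
    have : (T p, z + w) ∈ A ↔ (p, z) ∈ A := by
      change (p, z) ∈ Prod.map T (· + w) ⁻¹' A ↔ _
      rw [hTA]
    by_cases hy : (p, z) ∈ A
    · simp [hh, hy, this.2 hy]
    · simp [hh, hy, mt this.1 hy]
  -- The fibrewise Fourier coefficients of the indicator; translating by `w` in the fibre shows that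
  -- they are eigenfunctions of `T`.
  set g : ℤ → X → ℂ := fun k p => ∫ z, fourier (-k) z * h (p, z) with hg
  have hgm : ∀ k, Measurable (g k) := fun k => by
    refine (StronglyMeasurable.integral_prod_right' (f := fun y : X × UnitAddCircle =>
      fourier (-k) y.2 * h y) ?_).measurable
    exact ((((fourier (-k)).continuous.measurable.comp measurable_snd)).mul hm).stronglyMeasurable
  have hgle : ∀ k p, ‖g k p‖ ≤ 1 := fun k p => by
    refine (norm_integral_le_of_norm_le_const (C := 1) (Filter.Eventually.of_forall fun z => ?_)).trans
      (by simp)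
    rw [norm_mul, norm_fourier_apply, one_mul]
    exact hle _
  have hgT : ∀ k p, g k (T p) = fourier (-k) w * g k p := fun k p => by
    simp only [hg]
    conv_lhs => rw [← integral_add_right_eq_self _ w]
    rw [← integral_const_mul]
    refine integral_congr_ae (Filter.Eventually.of_forall fun z => ?_)
    simp only [fourier_apply_add, hinv]
    ring
  have hg0 : ∀ k, k ≠ 0 → g k =ᵐ[μ] 0 := fun k hk =>
    hw (-k) (neg_ne_zero.2 hk) (g k) (hgm k) (hgle k) (hgT k)
  obtain ⟨c, hc⟩ : ∃ c, g 0 =ᵐ[μ] fun _ => c :=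
    hT.ae_eq_const_of_ae_eq_comp_ae (hgm 0).aestronglyMeasurable
      (Filter.Eventually.of_forall fun p => by simp [hgT])
  have hsec : ∀ᵐ p ∂μ, ∀ᵐ z : UnitAddCircle, h (p, z) = c := by
    have hall : ∀ᵐ p ∂μ, ∀ k, k ≠ 0 → g k p = 0 := by
      rw [ae_all_iff]
      intro k
      by_cases hk : k = 0
      · simp [hk]
      · filter_upwards [hg0 k hk] with p hp _ using hp
    filter_upwards [hall, hc] with p hp hcp
    have hmp : Measurable fun z => h (p, z) := hm.comp measurable_prodMk_left
    have := ae_eq_zero_of_integral_fourier_eq_zero (f := fun z => h (p, z) - c) (C := 1 + ‖c‖)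
      (hmp.sub_const c) (fun z => (norm_sub_le _ _).trans (by gcongr; exact hle _)) fun k => by
        have hi1 : Integrable fun z : UnitAddCircle => fourier (-k) z * h (p, z) :=
          Integrable.of_bound ((fourier (-k)).continuous.measurable.mul hmp).aestronglyMeasurable 1
            (Filter.Eventually.of_forall fun z => by
              rw [norm_mul, norm_fourier_apply, one_mul]; exact hle _)
        have hi2 : Integrable fun z : UnitAddCircle => fourier (-k) z * c :=
          Integrable.of_bound ((fourier (-k)).continuous.measurable.mul_const c).aestronglyMeasurable
            ‖c‖ (Filter.Eventually.of_forall fun z => by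
              rw [norm_mul, norm_fourier_apply, one_mul])
        simp only [mul_sub]
        rw [integral_sub hi1 hi2, integral_mul_const]
        change g k p - _ = 0
        by_cases hk : k = 0
        · subst hk; rw [hcp]; simp
        · have hz : ∫ z : UnitAddCircle, fourier (-k) z = 0 := by
            have := fourierCoeff_fourier (T := 1) 0
            rw [volume_unitAddCircle_eq_haar]
            have h2 := congrFun this k
            simpa [fourierCoeff, hk] using h2
          rw [hp k hk, hz]; simp
    filter_upwards [this] with z hz
    exact sub_eq_zero.1 hz
  have hae : ∀ᵐ y ∂(μ.prod (volume : Measure UnitAddCircle)), h y = c :=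
    (Measure.ae_prod_iff_ae_ae (measurableSet_eq_fun hm measurable_const)).2 hsec
  rw [Filter.eventuallyConst_set]
  by_cases hc1 : c = 1
  · left
    filter_upwards [hae] with y hy
    by_contra hyA
    simp [hh, hyA, hc1] at hy
  · right
    filter_upwards [hae] with y hy hyA
    exact hc1 (by rw [← hy]; simp [hh, show y ∈ A from hyA])

/-! ### Integer relations and Kronecker vectors -/

theorem exists_int_of_mFourier_eq_fourier_pow {d : ℕ} {v : Fin d → ℝ} {w : ℝ} {m : Fin d → ℤ}
    {k : ℤ} {n : ℕ} (h : UnitAddTorus.mFourier m (fun i => ((v i : ℝ) : UnitAddCircle)) =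
      fourier k ((w : ℝ) : UnitAddCircle) ^ n) :
    ∃ j : ℤ, ∑ i, m i * v i - n * k * w = j := by
  have h1 : UnitAddTorus.mFourier m (fun i => ((v i : ℝ) : UnitAddCircle)) =
      Complex.exp (2 * Real.pi * Complex.I * (∑ i, m i * v i : ℝ)) := by
    simp only [UnitAddTorus.mFourier, ContinuousMap.coe_mk, fourier_coe_apply, ← Complex.exp_sum]
    push_cast
    rw [Finset.mul_sum]
    congr 1
    refine Finset.sum_congr rfl fun i _ => by ring
  rw [h1, fourier_coe_apply, ← Complex.exp_nat_mul, Complex.exp_eq_exp_iff_exists_int] at h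
  obtain ⟨j, hj⟩ := h
  refine ⟨j, ?_⟩
  have h2 : (2 * Real.pi * Complex.I : ℂ) ≠ 0 := Complex.two_pi_I_ne_zero
  have h3 : (2 * Real.pi * Complex.I : ℂ) * ((∑ i, m i * v i : ℝ) - n * k * w - j : ℂ) = 0 := by
    rw [mul_sub, mul_sub, hj]
    push_cast
    ring
  have h4 := (mul_eq_zero.1 h3).resolve_left h2
  have h5 : (((∑ i, m i * v i : ℝ) - n * k * w - j : ℝ) : ℂ) = 0 := by
    push_cast at h4 ⊢
    exact h4
  exact sub_eq_zero.1 (Complex.ofReal_eq_zero.1 h5)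

theorem IsKroneckerVector.ne_zero {d : ℕ} {v : Fin d → ℝ} (hv : IsKroneckerVector v) (i : Fin d) :
    v i ≠ 0 := by
  simpa using LinearIndependent.ne_zero i.castSucc hv

theorem IsKroneckerVector.int_relation_eq_zero {d : ℕ} {v : Fin d → ℝ} {w : ℝ}
    (hw : IsKroneckerVector (Fin.snoc (α := fun _ => ℝ) v w : Fin (d + 1) → ℝ))
    {m : Fin d → ℤ} {k j : ℤ} (h : ∑ i, m i * v i - k * w = j) : k = 0 := by
  have := Fintype.linearIndependent_iff.1 hw
    (Fin.snoc (α := fun _ => ℚ) (Fin.snoc (α := fun _ => ℚ) (fun i => (m i : ℚ)) (-k)) (-j)) (by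
      simp only [Fin.sum_univ_castSucc, Fin.snoc_castSucc, Fin.snoc_last, Rat.smul_def]
      push_cast
      linarith) (Fin.castSucc (Fin.last d))
  simpa using this

theorem IsKroneckerVector.exists_snoc {d : ℕ} {v : Fin d → ℝ} (hv : IsKroneckerVector v) :
    ∃ w : ℝ, IsKroneckerVector (Fin.snoc (α := fun _ => ℝ) v w : Fin (d + 1) → ℝ) := by
  -- The rational span of the `v i` and `1` is countable, so some real `w` lies outside it.
  obtain ⟨w, hw⟩ : ∃ w, w ∉ Set.range fun g : (Fin d → ℚ) × ℚ =>
      ∑ i, (g.1 i : ℝ) * v i + g.2 := by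
    by_contra! h
    exact Cardinal.not_countable_real
      ((Set.eq_univ_of_forall h) ▸ Set.countable_range _)
  refine ⟨w, Fintype.linearIndependent_iff.2 fun g hg => ?_⟩
  simp only [Fin.sum_univ_castSucc, Fin.snoc_castSucc, Fin.snoc_last, Rat.smul_def, mul_one] at hg
  set c := g (Fin.last d).castSucc with hc
  by_cases h0 : c = 0
  · have hv' := Fintype.linearIndependent_iff.1 hv
      (Fin.snoc (α := fun _ => ℚ) (fun i => g i.castSucc.castSucc) (g (Fin.last (d + 1)))) (by
        simp only [Fin.sum_univ_castSucc, Fin.snoc_castSucc, Fin.snoc_last, Rat.smul_def, mul_one]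
        rw [h0] at hg
        simpa using hg)
    intro i
    refine Fin.lastCases ?_ (fun i => Fin.lastCases ?_ (fun i => ?_) i) i
    · simpa using hv' (Fin.last d)
    · exact h0
    · simpa using hv' i.castSucc
  · refine (hw ⟨(fun i => -g i.castSucc.castSucc / c, -g (Fin.last (d + 1)) / c), ?_⟩).elim
    have hc' : (c : ℝ) ≠ 0 := Rat.cast_ne_zero.2 h0
    refine mul_left_cancel₀ hc' ?_
    simp only [mul_add, Finset.mul_sum, Rat.cast_div, Rat.cast_neg]
    have : ∀ i : Fin d, (c : ℝ) * (-(g i.castSucc.castSucc : ℝ) / c * v i) =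
        -(g i.castSucc.castSucc * v i) := fun i => by field_simp
    rw [Finset.sum_congr rfl fun i _ => this i, Finset.sum_neg_distrib, mul_div_cancel₀ _ hc']
    linarith

/-! ### Eigenvalues of the shift, and the product with the circle -/

namespace PolycubeManifold

variable {d s : ℕ}

/-- The norm of `g` is invariant, hence a.e. a constant `c`. If `c ≠ 0`, the product of `g` over the
cubes is a nonzero eigenfunction of the torus rotation, which forces `s * k = 0`. -/
theorem eigenfunction_ae_eq_zero {P : PolycubeManifold d s} {v : Fin d → ℝ} {w : ℝ}
    (hT : Ergodic (P.shift v) P.measure)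
    (hw : IsKroneckerVector (Fin.snoc (α := fun _ => ℝ) v w : Fin (d + 1) → ℝ))
    {k : ℤ} (hk : k ≠ 0) {g : P.Point → ℂ} (hg : Measurable g) (hle : ∀ p, ‖g p‖ ≤ 1)
    (hgT : ∀ p, g (P.shift v p) = fourier k ((w : ℝ) : UnitAddCircle) * g p) :
    g =ᵐ[P.measure] 0 := by
  obtain ⟨c, hc⟩ : ∃ c, (fun p => ‖g p‖) =ᵐ[P.measure] fun _ => c :=
    hT.ae_eq_const_of_ae_eq_comp_ae hg.norm.aestronglyMeasurable
      (Filter.Eventually.of_forall fun p => by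
        simp only [Function.comp_apply, hgT, norm_mul, norm_fourier_apply, one_mul])
  by_cases hc0 : c = 0
  · filter_upwards [hc] with p hp
    rw [hc0] at hp
    exact norm_eq_zero.1 hp
  exfalso
  have hF0 : ¬ (fun x => ∏ q, g (q, x)) =ᵐ[volume] 0 := by
    intro h0
    have h1 : ∀ᵐ y ∂((volume : Measure (Fin d → UnitAddCircle)).prod
        (Measure.count : Measure (Fin s))), ‖g y.swap‖ = c :=
      Measure.measurePreserving_swap.quasiMeasurePreserving.ae hc
    have h2 := Measure.ae_ae_of_ae_prod h1
    obtain ⟨x, hx0, hx⟩ := (h0.and h2).exists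
    rw [Measure.ae_count_iff] at hx
    obtain ⟨q, -, hq⟩ := Finset.prod_eq_zero_iff.1 hx0
    have := hx q
    rw [Prod.swap_prod_mk, hq, norm_zero] at this
    exact hc0 this.symm
  obtain ⟨m, hm⟩ := exists_mFourier_eq_of_eigenfunction (F := fun x => ∏ q, g (q, x)) (C := 1)
    (l := fourier k ((w : ℝ) : UnitAddCircle) ^ s)
    (Finset.measurable_prod _ fun q _ => hg.comp measurable_prodMk_left)
    (fun x => by
      rw [norm_prod]
      exact Finset.prod_le_one (fun _ _ => norm_nonneg _) fun q _ => hle _) hF0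
    (a := fun i => ((v i : ℝ) : UnitAddCircle)) (fun x => by
      -- The shift permutes the cubes over `x`, so the product may be reindexed; each of the `s`
      -- factors then contributes one eigenvalue.
      rw [← Equiv.prod_comp (P.cocycle v x)]
      have : ∀ q, g (P.cocycle v x q, x + fun i => ((v i : ℝ) : UnitAddCircle)) =
          fourier k ((w : ℝ) : UnitAddCircle) * g (q, x) := fun q => by
        rw [← hgT (q, x), shift_eq]
      simp only [this, Finset.prod_mul_distrib, Finset.prod_const, Finset.card_univ,
        Fintype.card_fin])
  obtain ⟨j, hj⟩ := exists_int_of_mFourier_eq_fourier_pow hm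
  have := hw.int_relation_eq_zero (m := m) (k := s * k) (j := j) (by push_cast; exact hj)
  have hs := P.pos
  rcases mul_eq_zero.1 this with h | h
  · omega
  · exact hk h

/-- A point of the product with the circle, as a point of the first factor and a point of the
circle. -/
noncomputable def prodCirclePointEquiv (P : PolycubeManifold d s) :
    P.prodCircle.Point ≃ᵐ P.Point × UnitAddCircle :=
  ((MeasurableEquiv.refl (Fin s)).prodCongr
    ((MeasurableEquiv.piFinSuccAbove (fun _ => UnitAddCircle) (Fin.last d)).trans
      MeasurableEquiv.prodComm)).trans MeasurableEquiv.prodAssoc.symm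

theorem prodCirclePointEquiv_apply (P : PolycubeManifold d s) (p : P.prodCircle.Point) :
    P.prodCirclePointEquiv p = ((p.1, fun i => p.2 i.castSucc), p.2 (Fin.last d)) := by
  refine Prod.ext (Prod.ext rfl (funext fun i => ?_)) rfl
  change p.2 ((Fin.last d).succAbove i) = _
  rw [Fin.succAbove_last]

theorem measurePreserving_prodCirclePointEquiv (P : PolycubeManifold d s) :
    MeasurePreserving P.prodCirclePointEquiv P.prodCircle.measure (P.measure.prod volume) := by
  have h1 := (MeasurePreserving.id (Measure.count : Measure (Fin s))).prod
    ((Measure.measurePreserving_swap (μ := (volume : Measure UnitAddCircle))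
      (ν := (volume : Measure (Fin d → UnitAddCircle)))).comp
      (volume_preserving_piFinSuccAbove (fun _ => UnitAddCircle) (Fin.last d)))
  have h2 := measurePreserving_prodAssoc (Measure.count : Measure (Fin s))
    (volume : Measure (Fin d → UnitAddCircle)) (volume : Measure UnitAddCircle)
  exact (h2.symm MeasurableEquiv.prodAssoc).comp h1

theorem line_snoc_castSucc (y : Fin (d + 1) → UnitAddCircle) (v : Fin d → ℝ) (w t : ℝ) (i : Fin d) :
    line y (Fin.snoc (α := fun _ => ℝ) v w) t i.castSucc =
      line (fun i => y i.castSucc) v t i := by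
  simp [line]

theorem cell_snoc_castSucc (y : Fin (d + 1) → UnitAddCircle) (v : Fin d → ℝ) (w t : ℝ) (i : Fin d) :
    cell y (Fin.snoc (α := fun _ => ℝ) v w) t i.castSucc =
      cell (fun i => y i.castSucc) v t i := by
  simp [cell, line_snoc_castSucc]

theorem Nonsingular.of_snoc {y : Fin (d + 1) → UnitAddCircle} {v : Fin d → ℝ} {w : ℝ}
    (h : Nonsingular y (Fin.snoc (α := fun _ => ℝ) v w)) :
    Nonsingular (fun i => y i.castSucc) v := by
  intro t ht i j hi hj
  simp only [← line_snoc_castSucc (w := w)] at hi hj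
  exact Fin.castSucc_injective d (h t ht _ _ hi hj)

/-- Crossing a face in the last direction leaves the projected cell unchanged, and the gluing there
is the identity. -/
theorem IsItinerary.prodCircle {P : PolycubeManifold d s} {q : Fin s}
    {y : Fin (d + 1) → UnitAddCircle} {v : Fin d → ℝ} {c : ℝ → Fin s}
    (hc : P.IsItinerary (q, fun i => y i.castSucc) v c) (w : ℝ) :
    P.prodCircle.IsItinerary (q, y) (Fin.snoc (α := fun _ => ℝ) v w) c where
  start := hc.start
  stay t ht t' ht' h := hc.stay t ht t' ht' (funext fun i => by
    simpa only [cell_snoc_castSucc] using congrFun h i.castSucc)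
  cross t ht t' ht' i h := by
    refine Fin.lastCases (fun h => ?_) (fun i h => ?_) i h
    · simp only [PolycubeManifold.prodCircle, Fin.snoc_last, Equiv.Perm.one_apply]
      refine hc.stay t ht t' ht' (funext fun i => ?_)
      have := congrFun h i.castSucc
      rwa [Pi.add_apply, Pi.single_eq_of_ne (Fin.castSucc_ne_last i), add_zero,
        cell_snoc_castSucc, cell_snoc_castSucc] at this
    · simp only [PolycubeManifold.prodCircle, Fin.snoc_castSucc]
      refine hc.cross t ht t' ht' i (funext fun j => ?_)
      have := congrFun h j.castSucc
      rw [Pi.add_apply, cell_snoc_castSucc, cell_snoc_castSucc] at this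
      rw [this, Pi.add_apply]
      by_cases hij : j = i
      · subst hij; simp
      · simp [hij]

theorem endCube_prodCircle {P : PolycubeManifold d s} {v : Fin d → ℝ} {w : ℝ}
    {p : P.prodCircle.Point} (hp : Nonsingular p.2 (Fin.snoc (α := fun _ => ℝ) v w)) :
    P.prodCircle.endCube (Fin.snoc (α := fun _ => ℝ) v w) p =
      P.endCube v (p.1, fun i => p.2 i.castSucc) := by
  obtain ⟨c, hc⟩ := P.exists_isItinerary (p.1, fun i => p.2 i.castSucc) v
  rw [endCube_eq_of_isItinerary hp.of_snoc hc, endCube_eq_of_isItinerary hp (hc.prodCircle w)]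

/-- Only a.e.: a segment may be singular in the product although its projection is not, and then
`endCube` takes its default value. -/
theorem shift_prodCircle_ae_eq (P : PolycubeManifold d s) {v : Fin d → ℝ} {w : ℝ}
    (hw : IsKroneckerVector (Fin.snoc (α := fun _ => ℝ) v w : Fin (d + 1) → ℝ)) :
    P.prodCircle.shift (Fin.snoc (α := fun _ => ℝ) v w) =ᵐ[P.prodCircle.measure]
      P.prodCirclePointEquiv.symm ∘ Prod.map (P.shift v) (· + ((w : ℝ) : UnitAddCircle)) ∘
        P.prodCirclePointEquiv := by
  have hns : ∀ᵐ p ∂P.prodCircle.measure,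
      Nonsingular p.2 (Fin.snoc (α := fun _ => ℝ) v w : Fin (d + 1) → ℝ) :=
    Measure.quasiMeasurePreserving_snd.ae (ae_nonsingular hw.ne_zero)
  filter_upwards [hns] with p hp
  rw [Function.comp_apply, MeasurableEquiv.eq_symm_apply, Function.comp_apply,
    prodCirclePointEquiv_apply, prodCirclePointEquiv_apply]
  simp [shift, endCube_prodCircle hp]

theorem ergodic_shift_prodCircle_iff (P : PolycubeManifold d s) {v : Fin d → ℝ} {w : ℝ}
    (hw : IsKroneckerVector (Fin.snoc (α := fun _ => ℝ) v w : Fin (d + 1) → ℝ)) :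
    Ergodic (P.prodCircle.shift (Fin.snoc (α := fun _ => ℝ) v w)) P.prodCircle.measure ↔
      Ergodic (Prod.map (P.shift v) (· + ((w : ℝ) : UnitAddCircle)))
        (P.measure.prod volume) := by
  have he := P.measurePreserving_prodCirclePointEquiv
  have hmp := (he.symm _).comp (((P.measurePreserving_shift v).prod
    (measurePreserving_add_right volume ((w : ℝ) : UnitAddCircle))).comp he)
  have hconj := (he.symm _).ergodic_conjugate_iff
    (f := Prod.map (P.shift v) (· + ((w : ℝ) : UnitAddCircle)))
  rw [MeasurableEquiv.symm_symm] at hconj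
  rw [← hconj]
  have hae := P.shift_prodCircle_ae_eq hw
  exact ⟨fun h => h.congr_ae hmp hae,
    fun h => h.congr_ae (P.prodCircle.measurePreserving_shift _) hae.symm⟩

end PolycubeManifold

theorem theorem5 {s : ℕ} (P : PolycubeManifold 2 s) (v : Fin 2 → ℝ) (hv : IsKroneckerVector v) :
    Ergodic (P.shift v) P.measure ↔
      ∀ w : ℝ, IsKroneckerVector (Fin.snoc (α := fun _ => ℝ) v w : Fin 3 → ℝ) →
        Ergodic (P.prodCircle.shift (Fin.snoc (α := fun _ => ℝ) v w : Fin 3 → ℝ))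
          P.prodCircle.measure := by
  constructor
  · intro h w hw
    exact (P.ergodic_shift_prodCircle_iff hw).2 (h.prodMap_add_right fun k hk g hg hle hgT =>
      PolycubeManifold.eigenfunction_ae_eq_zero h hw hk hg hle hgT)
  · intro h
    obtain ⟨w, hw⟩ := hv.exists_snoc
    -- The first projection makes the `v`-shift a factor of the product map, and factors of ergodic
    -- maps are ergodic.
    exact MeasurePreserving.ergodic_of_ergodic_semiconj measurePreserving_fst
      ((P.ergodic_shift_prodCircle_iff hw).1 (h w hw)) (P.measurePreserving_shift v).measurable
      (fun _ => rfl)
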